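/- For $n\in\mathbb N$ let $H_n$ be the $n$-dimensional hypercube, i.e. the graph on $\{0,1\}^n$ in which two strings are adjacent iff their Hamming distance is $1$. For a finite relational structure $\mathfrak A$ with universe $A$, let $\mathrm{HF}(A)$ be the set of hereditarily finite objects over the atom set $A$, and let $\mathrm{tc}(x)$ be the least transitive set containing $x$ as an element. A *CPT program* $\Pi$ (Choiceless Polynomial Time with counting, in the form of BGS logic) consists of terms $\Pi_{\mathrm{step}}(X,Y)$, $\Pi_{\mathrm{out}}(X,Y)$, a formula $\Pi_{\mathrm{halt}}(X,Y)$ and a polynomial $p$. Terms are built from variables, $\emptyset$ and $\mathrm{Atoms}$ by $\{s,t\}$, $\bigcup t$, $\mathrm{Unique}(t)$ (the element of $t$ if $t$ is a singleton, else $\emptyset$), $\mathrm{Card}(t)$ (the number of elements, as a von Neumann ordinal) and comprehension $\{t(x) : x\in s,\ \varphi(x)\}$; formulas are Boolean combinations of $s=t$, $s\in t$ and $R(t_1,\dots,t_m)$ for relations $R$ of $\mathfrak A$. On input $\mathfrak A$ and $y\in\mathrm{HF}(A)$ (with $y=\emptyset$ if only $\mathfrak A$ is given) the run has states $x_0=\emptyset$,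 $x_{i+1}=\Pi_{\mathrm{step}}(x_i,y)$, up to the first state satisfying $\Pi_{\mathrm{halt}}$; it may make at most $p(|A|)$ steps, and all states and the output must satisfy $|\mathrm{tc}(\cdot)|\le p(|A|)$. If the run halts at $x_i$ within these bounds, $\Pi$ *outputs* $\Pi_{\mathrm{out}}(x_i,y)$. We say that $\Pi$ *computes* $x\in\mathrm{HF}(A)$ on $\mathfrak A$ if $x\in \mathrm{tc}(z)$ for some stage $z$ that the run on $\mathfrak A$ reaches within the bounds, or for the output $z$ of $\Pi$ on $\mathfrak A$ (in particular, if $x$ is itself a stage or the output). A total preorder on $A$ has colour classes $C_1,\dots,C_m$, listed in increasing order. An object $x\in\mathrm{HF}(A)$ *represents* (encodes) the preorder over $\mathfrak A$ if some CPT program outputs $\{C_1,\{C_2,\{C_3,\{\dots\{C_m\}\dots\}\}\}\}$ on input $\mathfrak A$ and $x$. **Corollary.** There is no CPT program $\Pi$ for which there exist total preorders $\preceq_n$ on $\{0,1\}^n$ $(n\in\mathbb N)$ such that the maximal size of a colour class of $\preceq_n$ is in $\mathcal O(n)=\mathcal O(\log|H_n|)$ and such that, for every $n$, $\Pi$ computes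 on $H_n$ some $x_n\in\mathrm{HF}(\{0,1\}^n)$ that represents $\preceq_n$. -/

import Mathlib

open Asymptotics Filter

/-! ### Hereditarily finite sets over a set of atoms -/

/-- `HF A` is the collection of hereditarily finite objects over the atom set `A`: the atoms
themselves and all sets obtained from them by iterated formation of finite sets, up to
extensional equality. -/
abbrev HF (A : Type) : Type := Finsets A

namespace HF

variable {A : Type}

/-- The hereditarily finite object described by a hereditarily finite list. -/
def mk (l : Lists A) : HF A := Quotient.mk Lists.instSetoidLists l

/-- A hereditarily finite list that describes `x`. -/
noncomputable def repr (x : HF A) : Lists A := Quotient.out (s := Lists.instSetoidLists) x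

theorem mk_repr (x : HF A) : mk (repr x) = x := Quotient.out_eq (s := Lists.instSetoidLists) x

theorem mk_eq_mk {l m : Lists A} : mk l = mk m ↔ Lists.Equiv l m :=
  ⟨fun h => Quotient.exact h, fun h => Quotient.sound h⟩

/-- The atom `a`, viewed as a hereditarily finite object. -/
def atom (a : A) : HF A := mk (Lists.atom a)

open Classical in
/-- The finite set of elements of a hereditarily finite object. An atom has no elements. -/
noncomputable def elements (x : HF A) : Finset (HF A) :=
  Quotient.lift (s := Lists.instSetoidLists)
    (fun l : Lists A => (l.toList.map mk).toFinset)
    (by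
      intro l₁ l₂ h
      cases h with
      | refl => rfl
      | antisymm h₁ h₂ =>
        ext y
        rw [List.mem_toFinset, List.mem_toFinset, List.mem_map, List.mem_map]
        constructor
        · rintro ⟨a, ha, rfl⟩
          obtain ⟨b, hb, e⟩ := Lists'.mem_of_subset' h₁ ha
          exact ⟨b, hb, mk_eq_mk.2 e.symm⟩
        · rintro ⟨a, ha, rfl⟩
          obtain ⟨b, hb, e⟩ := Lists'.mem_of_subset' h₂ ha
          exact ⟨b, hb, mk_eq_mk.2 e.symm⟩) x

/-- The hereditarily finite set with a given finite set of elements. -/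
noncomputable def ofFinset (s : Finset (HF A)) : HF A := mk (Lists.ofList (s.toList.map repr))

theorem mem_elements_mk {l : Lists A} {y : HF A} :
    y ∈ elements (mk l) ↔ ∃ a ∈ l.toList, mk a = y := by
  classical
  change y ∈ List.toFinset (l.toList.map mk) ↔ _
  rw [List.mem_toFinset, List.mem_map]

@[simp]
theorem elements_atom (a : A) : (atom a).elements = ∅ := rfl

@[simp]
theorem elements_ofFinset (s : Finset (HF A)) : (ofFinset s).elements = s := by
  ext y
  rw [ofFinset, mem_elements_mk, Lists.to_ofList]
  constructor
  · rintro ⟨a, ha, rfl⟩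
    obtain ⟨b, hb, rfl⟩ := List.mem_map.1 ha
    rw [mk_repr]
    exact Finset.mem_toList.1 hb
  · intro hy
    exact ⟨repr y, List.mem_map.2 ⟨y, Finset.mem_toList.2 hy, rfl⟩, mk_repr y⟩

theorem atom_injective : Function.Injective (atom : A → HF A) := by
  intro a b h
  have := Lists.equiv_atom.1 (mk_eq_mk.1 h)
  cases this
  rfl

theorem atom_ne_ofFinset (a : A) (s : Finset (HF A)) : atom a ≠ ofFinset s := by
  intro h
  have := Lists.equiv_atom.1 (mk_eq_mk.1 h)
  cases this

/-- A hereditarily finite object that is described by a proper list is the set of its elements. -/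
theorem mk_of'_eq_ofFinset (l : Lists' A true) :
    mk (Lists.of' l) = ofFinset (elements (mk (Lists.of' l))) := by
  refine mk_eq_mk.2 (Lists.Equiv.antisymm_iff.2 ⟨?_, ?_⟩)
  · refine Lists'.subset_def.2 fun a ha => Lists'.mem_def.2 ?_
    rw [Lists'.to_ofList]
    refine ⟨repr (mk a), List.mem_map.2 ⟨_, ?_, rfl⟩, mk_eq_mk.1 (mk_repr _).symm⟩
    exact Finset.mem_toList.2 (mem_elements_mk.2 ⟨a, ha, rfl⟩)
  · refine Lists'.subset_def.2 fun a ha => Lists'.mem_def.2 ?_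
    rw [Lists'.to_ofList] at ha
    obtain ⟨b, hb, rfl⟩ := List.mem_map.1 ha
    obtain ⟨c, hc, rfl⟩ := mem_elements_mk.1 (Finset.mem_toList.1 hb)
    exact ⟨c, hc, mk_eq_mk.1 (mk_repr _)⟩

/-- Induction on hereditarily finite objects. -/
theorem induction {motive : HF A → Prop} (h_atom : ∀ a, motive (atom a))
    (h_set : ∀ s : Finset (HF A), (∀ y ∈ s, motive y) → motive (ofFinset s)) (x : HF A) :
    motive x := by
  have key := Lists.inductionMut (fun l : Lists A => motive (mk l))
    (fun l : Lists' A true => ∀ y ∈ l.toList, motive (mk y)) h_atom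
    (by
      intro l hl
      rw [mk_of'_eq_ofFinset]
      apply h_set
      intro y hy
      obtain ⟨c, hc, rfl⟩ := mem_elements_mk.1 hy
      exact hl c hc)
    (by intro y hy; cases hy)
    (by
      intro a l ha hl y hy
      rw [Lists'.toList_cons] at hy
      rcases List.mem_cons.1 hy with rfl | hy
      · exact ha
      · exact hl y hy)
  exact Quotient.inductionOn x key.1

/-- The empty set. -/
noncomputable def empty : HF A := ofFinset ∅

open Classical in
/-- The unordered pair `{x, y}`. -/
noncomputable def pair (x y : HF A) : HF A := ofFinset {x, y}

open Classical in
/-- The union of all elements of `x`. -/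
noncomputable def sUnion (x : HF A) : HF A := ofFinset (x.elements.biUnion elements)

open Classical in
/-- The unique element of `x` if `x` is a singleton, and `∅` otherwise. -/
noncomputable def unique (x : HF A) : HF A :=
  if h : ∃ y, x.elements = {y} then h.choose else empty

open Classical in
/-- The natural number `n` as a von Neumann ordinal. -/
noncomputable def ordinal : ℕ → HF A
  | 0 => empty
  | n + 1 => ofFinset (insert (ordinal n) (ordinal n).elements)

open Classical in
/-- The set of those hereditarily finite objects that are atoms from `s`. -/
noncomputable def ofAtoms (s : Finset A) : HF A := ofFinset (s.image atom)

/-- The transitive closure: the least transitive set that contains `x` as an element. -/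
def tc (x : HF A) : Set (HF A) := {y | Relation.ReflTransGen (fun a b => a ∈ b.elements) y x}

theorem tc_eq_sInter (x : HF A) :
    tc x = ⋂₀ {T : Set (HF A) | x ∈ T ∧ ∀ a ∈ T, (a.elements : Set (HF A)) ⊆ T} := by
  apply Set.Subset.antisymm
  · intro y hy T hT
    induction hy using Relation.ReflTransGen.head_induction_on with
    | refl => exact hT.1
    | head h _ ih => exact hT.2 _ ih h
  · apply Set.sInter_subset_of_mem
    refine ⟨Relation.ReflTransGen.refl, ?_⟩
    intro a ha b hb
    exact Relation.ReflTransGen.head hb ha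

theorem tc_finite (x : HF A) : (tc x).Finite := by
  induction x using HF.induction with
  | h_atom a =>
    refine (Set.finite_singleton (atom a)).subset fun y hy => ?_
    rcases Relation.ReflTransGen.cases_tail hy with h | ⟨c, _, hc⟩
    · exact h.symm
    · simp at hc
  | h_set s ih =>
    refine ((Set.finite_singleton (ofFinset s)).union
      (Set.Finite.biUnion s.finite_toSet ih)).subset fun y hy => ?_
    rcases Relation.ReflTransGen.cases_tail hy with h | ⟨c, hy, hc⟩
    · exact Or.inl h.symm
    · rw [elements_ofFinset] at hc
      exact Or.inr (Set.mem_biUnion (Finset.mem_coe.2 hc) hy)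

end HF

/-! ### Choiceless Polynomial Time with counting, in the presentation as BGS logic -/

mutual
  /-- Terms over the relational vocabulary of `L`, with `k` free variables. Their values are
  hereditarily finite objects. -/
  inductive CPTTerm (L : FirstOrder.Language.{0, 0}) : ℕ → Type
    | var {k : ℕ} (i : Fin k) : CPTTerm L k
    | empty {k : ℕ} : CPTTerm L k
    | atoms {k : ℕ} : CPTTerm L k
    | pair {k : ℕ} (s t : CPTTerm L k) : CPTTerm L k
    | sUnion {k : ℕ} (t : CPTTerm L k) : CPTTerm L k
    | unique {k : ℕ} (t : CPTTerm L k) : CPTTerm L k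
    | card {k : ℕ} (t : CPTTerm L k) : CPTTerm L k
    /-- `{ t(x) : x ∈ s, φ(x) }`. The bound variable `x` is variable `0` of `t` and `φ`; it does
    not occur in `s`. -/
    | comprehension {k : ℕ} (t : CPTTerm L (k + 1)) (s : CPTTerm L k)
        (φ : CPTFormula L (k + 1)) : CPTTerm L k
  /-- Formulas over the relational vocabulary of `L`, with `k` free variables. -/
  inductive CPTFormula (L : FirstOrder.Language.{0, 0}) : ℕ → Type
    | eq {k : ℕ} (s t : CPTTerm L k) : CPTFormula L k
    | mem {k : ℕ} (s t : CPTTerm L k) : CPTFormula L k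
    | rel {k m : ℕ} (R : L.Relations m) (ts : Fin m → CPTTerm L k) : CPTFormula L k
    | not {k : ℕ} (φ : CPTFormula L k) : CPTFormula L k
    | and {k : ℕ} (φ ψ : CPTFormula L k) : CPTFormula L k
end

open Classical in
mutual
  /-- The value of a term in the structure on `A` under the assignment `ρ`. -/
  noncomputable def CPTTerm.eval {L : FirstOrder.Language.{0, 0}} {A : Type} [Fintype A] [L.Structure A] :
      {k : ℕ} → CPTTerm L k → (Fin k → HF A) → HF A
    | _, .var i, ρ => ρ i
    | _, .empty, _ => HF.empty
    | _, .atoms, _ => HF.ofAtoms Finset.univ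
    | _, .pair s t, ρ => HF.pair (s.eval ρ) (t.eval ρ)
    | _, .sUnion t, ρ => HF.sUnion (t.eval ρ)
    | _, .unique t, ρ => HF.unique (t.eval ρ)
    | _, .card t, ρ => HF.ordinal (t.eval ρ).elements.card
    | _, .comprehension t s φ, ρ =>
        HF.ofFinset
          (((s.eval ρ).elements.filter
            (fun b => φ.Holds (Fin.cons (α := fun _ => HF A) b ρ))).image
            (fun b => t.eval (Fin.cons (α := fun _ => HF A) b ρ)))
  /-- Truth of a formula in the structure on `A` under the assignment `ρ`. -/
  noncomputable def CPTFormula.Holds {L : FirstOrder.Language.{0, 0}} {A : Type} [Fintype A] [L.Structure A] :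
      {k : ℕ} → CPTFormula L k → (Fin k → HF A) → Prop
    | _, .eq s t, ρ => s.eval ρ = t.eval ρ
    | _, .mem s t, ρ => s.eval ρ ∈ (t.eval ρ).elements
    | _, .rel R ts, ρ =>
        ∃ a : Fin _ → A, (∀ i, (ts i).eval ρ = HF.atom (a i)) ∧ FirstOrder.Language.Structure.RelMap R a
    | _, .not φ, ρ => ¬ φ.Holds ρ
    | _, .and φ ψ, ρ => φ.Holds ρ ∧ ψ.Holds ρ
end

/-- A program of Choiceless Polynomial Time with counting: a step term, a halting formula, an
output term and an explicit polynomial bound. Variable `0` stands for the current state and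
variable `1` for an additional hereditarily finite input, which is `∅` for programs that take
only a structure as input. -/
structure CPTProgram (L : FirstOrder.Language.{0, 0}) where
  step : CPTTerm L 2
  halt : CPTFormula L 2
  out : CPTTerm L 2
  bound : Polynomial ℕ

namespace CPTProgram

variable {L : FirstOrder.Language.{0, 0}} (P : CPTProgram L) {A : Type} [Fintype A] [L.Structure A]

/-- `x` is `p`-bounded for the bound `p` of the program: `|tc x| ≤ p (|A|)`. -/
def Bounded (x : HF A) : Prop := (HF.tc x).ncard ≤ P.bound.eval (Fintype.card A)

/-- The `i`-th state on input `y`. The initial state is `∅`. -/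
noncomputable def state (y : HF A) : ℕ → HF A
  | 0 => HF.empty
  | i + 1 => P.step.eval ![state y i, y]

/-- The run on input `y` gets to its `i`-th state: it has not halted before, and it respects the
polynomial bound on the number of steps and on the size of the states. -/
def Reaches (y : HF A) (i : ℕ) : Prop :=
  i ≤ P.bound.eval (Fintype.card A) ∧
    (∀ j < i, ¬ P.halt.Holds ![P.state y j, y]) ∧ ∀ j ≤ i, P.Bounded (P.state y j)

/-- The run on input `y` halts within its bound and its output is `z`. -/
def Outputs (y z : HF A) : Prop :=
  ∃ i, P.Reaches y i ∧ P.halt.Holds ![P.state y i, y] ∧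
    z = P.out.eval ![P.state y i, y] ∧ P.Bounded z

/-- The program computes `x` on the structure `A` (with no additional input): `x` appears in the
transitive closure of some stage of the run or in that of the output. As `x ∈ tc x`, this covers
in particular the case that `x` itself is a stage or the output. -/
def Computes (x : HF A) : Prop :=
  (∃ i, P.Reaches (HF.empty : HF A) i ∧ x ∈ HF.tc (P.state (HF.empty : HF A) i)) ∨
    ∃ z : HF A, P.Outputs HF.empty z ∧ x ∈ HF.tc z

end CPTProgram

/-! ### Preorders, colour classes and their encodings -/

open Classical in
/-- The colour class of `v` with respect to the total preorder `r`. -/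
noncomputable def colourClass {A : Type} [Fintype A] (r : A → A → Prop) (v : A) : Finset A :=
  {w | r v w ∧ r w v}

/-- The size of the largest colour class. -/
noncomputable def maxColourClassSize {A : Type} [Fintype A] (r : A → A → Prop) : ℕ :=
  Finset.univ.sup fun v => (colourClass r v).card

/-- `l` is the sequence `C₁, …, Cₘ` of all colour classes of `r`, in increasing order. -/
def IsColourSequence {A : Type} [Fintype A] (r : A → A → Prop) (l : List (Finset A)) : Prop :=
  (∀ C, C ∈ l ↔ ∃ v, C = colourClass r v) ∧
    l.Pairwise fun C D => ∀ v ∈ C, ∀ w ∈ D, r v w ∧ ¬ r w v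

/-- The natural representation `{C₁, {C₂, {C₃, { … {Cₘ} … }}}}` of an ordered partition. -/
noncomputable def nestedRep {A : Type} : List (Finset A) → HF A
  | [] => HF.empty
  | [C] => HF.pair (HF.ofAtoms C) (HF.ofAtoms C)
  | C :: D :: l => HF.pair (HF.ofAtoms C) (nestedRep (D :: l))

/-- `x` encodes the total preorder `r` over the structure on `A`: some program outputs the natural
representation of the sequence of colour classes of `r` on input the structure and `x`. -/
def Encodes (L : FirstOrder.Language.{0, 0}) {A : Type} [Fintype A] [L.Structure A] (x : HF A)
    (r : A → A → Prop) : Prop :=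
  ∃ l : List (Finset A), IsColourSequence r l ∧
    ∃ Q : CPTProgram L, Q.Outputs x (nestedRep l)

/-! ### Hypercubes -/

/-- The `n`-dimensional hypercube graph. -/
def hypercube (n : ℕ) : SimpleGraph (Fin n → Bool) where
  Adj u v := hammingDist u v = 1
  symm := ⟨fun u v h => by rw [hammingDist_comm]; exact h⟩
  loopless := ⟨fun u h => by simp at h⟩

/-- The hypercube as a finite relational structure. -/
instance hypercubeStructure (n : ℕ) : FirstOrder.Language.graph.Structure (Fin n → Bool) :=
  (hypercube n).structure

open scoped FirstOrder

namespace HF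

variable {A : Type}

theorem exists_atom_or_ofFinset (x : HF A) :
    (∃ a, x = atom a) ∨ ∃ s : Finset (HF A), x = ofFinset s := by
  induction x using HF.induction with
  | h_atom a => exact Or.inl ⟨a, rfl⟩
  | h_set s _ => exact Or.inr ⟨s, rfl⟩

theorem ofFinset_injective : Function.Injective (ofFinset : Finset (HF A) → HF A) :=
  Function.LeftInverse.injective elements_ofFinset

theorem wellFounded_mem_elements : WellFounded fun x y : HF A => x ∈ y.elements := by
  refine ⟨fun x => ?_⟩
  induction x using HF.induction with
  | h_atom a => exact ⟨_, fun y hy => by simp at hy⟩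
  | h_set s ih => exact ⟨_, fun y hy => ih y (by simpa using hy)⟩

open Classical in
/-- The action of a map between atom sets on hereditarily finite objects. -/
noncomputable def map (f : A → A) : HF A → HF A :=
  wellFounded_mem_elements.fix fun x F =>
    if h : ∃ a, x = atom a then atom (f h.choose)
    else ofFinset (x.elements.attach.image fun y => F y.1 y.2)

@[simp]
theorem map_atom (f : A → A) (a : A) : map f (atom a) = atom (f a) := by
  rw [map, WellFounded.fix_eq]
  have h : ∃ b, (atom a : HF A) = atom b := ⟨a, rfl⟩
  rw [dif_pos h, ← atom_injective h.choose_spec]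

open Classical in
@[simp]
theorem map_ofFinset (f : A → A) (s : Finset (HF A)) :
    map f (ofFinset s) = ofFinset (s.image (map f)) := by
  rw [map, WellFounded.fix_eq]
  have h : ¬ ∃ b, (ofFinset s : HF A) = atom b := fun ⟨b, hb⟩ => atom_ne_ofFinset b s hb.symm
  rw [dif_neg h]
  congr 1
  ext y
  simp

open Classical in
@[simp]
theorem elements_map (f : A → A) (x : HF A) : (map f x).elements = x.elements.image (map f) := by
  rcases exists_atom_or_ofFinset x with ⟨a, rfl⟩ | ⟨s, rfl⟩ <;> simp

theorem map_map (f g : A → A) (x : HF A) : map f (map g x) = map (f ∘ g) x := by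
  classical
  induction x using HF.induction with
  | h_atom a => simp
  | h_set s ih =>
    rw [map_ofFinset, map_ofFinset, map_ofFinset, Finset.image_image]
    exact congrArg ofFinset (Finset.image_congr ih)

theorem map_id (x : HF A) : map id x = x := by
  classical
  induction x using HF.induction with
  | h_atom a => simp
  | h_set s ih =>
    rw [map_ofFinset, Finset.image_congr (g := id) ih, Finset.image_id]

theorem map_injective (e : A ≃ A) : Function.Injective (map e) :=
  Function.LeftInverse.injective (g := map e.symm) fun x => by
    rw [map_map, e.symm_comp_self, map_id]

theorem map_empty (f : A → A) : map f empty = empty := by simp [empty]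

theorem map_pair (f : A → A) (x y : HF A) : map f (pair x y) = pair (map f x) (map f y) := by
  simp [pair]

theorem map_sUnion (f : A → A) (x : HF A) : map f (sUnion x) = sUnion (map f x) := by
  simp only [sUnion, map_ofFinset, elements_map, Finset.biUnion_image, Finset.image_biUnion]

theorem unique_of_elements_eq {x y : HF A} (h : x.elements = {y}) : unique x = y := by
  have hx : ∃ y, x.elements = {y} := ⟨y, h⟩
  rw [unique, dif_pos hx]
  exact Finset.singleton_injective (hx.choose_spec.symm.trans h)

theorem map_unique (e : A ≃ A) (x : HF A) : map e (unique x) = unique (map e x) := by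
  classical
  by_cases h : ∃ y, x.elements = {y}
  · obtain ⟨y, hy⟩ := h
    rw [unique_of_elements_eq hy, unique_of_elements_eq (y := map e y) (by simp [hy])]
  · have h' : ¬ ∃ y, (map e x).elements = {y} := by
      rintro ⟨y, hy⟩
      apply h
      rw [← Finset.card_eq_one, ← Finset.card_image_of_injective _ (map_injective e),
        ← elements_map, hy, Finset.card_singleton]
    rw [unique, unique, dif_neg h, dif_neg h', map_empty]

theorem map_ordinal (f : A → A) (n : ℕ) : map f (ordinal n) = ordinal n := by
  classical
  induction n with
  | zero => exact map_empty f
  | succ n ih =>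
    have := elements_map f (ordinal n)
    rw [ih] at this
    rw [ordinal, map_ofFinset, Finset.image_insert, ih, ← this]

open Classical in
theorem map_ofAtoms (f : A → A) (s : Finset A) : map f (ofAtoms s) = ofAtoms (s.image f) := by
  rw [ofAtoms, ofAtoms, map_ofFinset, Finset.image_image, Finset.image_image]
  exact congrArg ofFinset (Finset.image_congr fun a _ => map_atom f a)

theorem ofAtoms_injective : Function.Injective (ofAtoms : Finset A → HF A) := by
  classical
  intro s t h
  exact Finset.image_injective atom_injective (ofFinset_injective h)

theorem map_mem_tc {f : A → A} {x z : HF A} (h : x ∈ tc z) : map f x ∈ tc (map f z) := by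
  classical
  refine Relation.ReflTransGen.lift (p := fun a b : HF A => a ∈ b.elements) (map f) ?_ _ _ h
  intro a b hab
  change map f a ∈ (map f b).elements
  rw [elements_map]
  exact Finset.mem_image_of_mem _ hab

theorem map_comp_cons (f : A → A) {k : ℕ} (b : HF A) (ρ : Fin k → HF A) :
    (Fin.cons (α := fun _ => HF A) (map f b) (map f ∘ ρ) : Fin (k + 1) → HF A) =
      map f ∘ Fin.cons (α := fun _ => HF A) b ρ := by
  funext i
  refine Fin.cases ?_ (fun j => ?_) i <;> rfl

theorem map_comp_vec (f : A → A) (x y : HF A) :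
    (![map f x, map f y] : Fin 2 → HF A) = map f ∘ ![x, y] := by
  funext i
  fin_cases i <;> rfl

end HF

section Invariance

variable {L : FirstOrder.Language.{0, 0}} {A : Type} [Fintype A] [L.Structure A]

mutual

theorem CPTTerm.eval_map (e : A ≃[L] A) : ∀ {k : ℕ} (t : CPTTerm L k) (ρ : Fin k → HF A),
    t.eval (HF.map e.toEquiv ∘ ρ) = HF.map e.toEquiv (t.eval ρ)
  | _, .var i, ρ => by simp only [CPTTerm.eval, Function.comp]
  | _, .empty, ρ => by simp only [CPTTerm.eval, HF.map_empty]
  | _, .atoms, ρ => by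
    classical
    simp only [CPTTerm.eval, HF.map_ofAtoms]
    rw [Finset.image_univ_of_surjective e.toEquiv.surjective]
  | _, .pair s t, ρ => by
    simp only [CPTTerm.eval, HF.map_pair, CPTTerm.eval_map e s ρ, CPTTerm.eval_map e t ρ]
  | _, .sUnion t, ρ => by simp only [CPTTerm.eval, HF.map_sUnion, CPTTerm.eval_map e t ρ]
  | _, .unique t, ρ => by simp only [CPTTerm.eval, HF.map_unique, CPTTerm.eval_map e t ρ]
  | _, .card t, ρ => by
    classical
    simp only [CPTTerm.eval, HF.map_ordinal, CPTTerm.eval_map e t ρ, HF.elements_map]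
    rw [Finset.card_image_of_injective _ (HF.map_injective e.toEquiv)]
  | _, .comprehension t s φ, ρ => by
    classical
    simp only [CPTTerm.eval, HF.map_ofFinset, CPTTerm.eval_map e s ρ, HF.elements_map]
    congr 1
    ext y
    simp only [Finset.mem_image, Finset.mem_filter]
    constructor
    · rintro ⟨_, ⟨⟨b, hb, rfl⟩, hφ⟩, rfl⟩
      rw [HF.map_comp_cons, CPTFormula.holds_map e φ] at hφ
      refine ⟨_, ⟨b, ⟨hb, hφ⟩, rfl⟩, ?_⟩
      rw [HF.map_comp_cons, CPTTerm.eval_map e t]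
    · rintro ⟨_, ⟨b, ⟨hb, hφ⟩, rfl⟩, rfl⟩
      refine ⟨HF.map e.toEquiv b, ⟨⟨b, hb, rfl⟩, ?_⟩, ?_⟩
      · rwa [HF.map_comp_cons, CPTFormula.holds_map e φ]
      · rw [HF.map_comp_cons, CPTTerm.eval_map e t]

theorem CPTFormula.holds_map (e : A ≃[L] A) : ∀ {k : ℕ} (φ : CPTFormula L k) (ρ : Fin k → HF A),
    φ.Holds (HF.map e.toEquiv ∘ ρ) ↔ φ.Holds ρ
  | _, .eq s t, ρ => by
    simp only [CPTFormula.Holds, CPTTerm.eval_map e s ρ, CPTTerm.eval_map e t ρ,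
      (HF.map_injective e.toEquiv).eq_iff]
  | _, .mem s t, ρ => by
    classical
    simp only [CPTFormula.Holds, CPTTerm.eval_map e s ρ, CPTTerm.eval_map e t ρ, HF.elements_map]
    rw [(HF.map_injective e.toEquiv).mem_finset_image]
  | _, .rel R ts, ρ => by
    simp only [CPTFormula.Holds]
    have h i := CPTTerm.eval_map e (ts i) ρ
    simp only [h]
    constructor
    · rintro ⟨a, ha, hR⟩
      refine ⟨e.symm ∘ a, fun i => HF.map_injective e.toEquiv ?_, ?_⟩
      · rw [ha i, HF.map_atom]
        exact congrArg HF.atom (e.apply_symm_apply (a i)).symm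
      · exact (e.symm.map_rel R a).2 hR
    · rintro ⟨a, ha, hR⟩
      refine ⟨e ∘ a, fun i => ?_, (e.map_rel R a).2 hR⟩
      rw [ha i, HF.map_atom]
      rfl
  | _, .not φ, ρ => by simp only [CPTFormula.Holds, CPTFormula.holds_map e φ ρ]
  | _, .and φ ψ, ρ => by
    simp only [CPTFormula.Holds, CPTFormula.holds_map e φ ρ, CPTFormula.holds_map e ψ ρ]

end

namespace CPTProgram

variable (P : CPTProgram L)

theorem map_eval_of_fixed {e : A ≃[L] A} (t : CPTTerm L 2) {x y : HF A}
    (hx : HF.map e.toEquiv x = x) (hy : HF.map e.toEquiv y = y) :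
    HF.map e.toEquiv (t.eval ![x, y]) = t.eval ![x, y] := by
  rw [← CPTTerm.eval_map, ← HF.map_comp_vec, hx, hy]

theorem map_state {e : A ≃[L] A} {y : HF A} (hy : HF.map e.toEquiv y = y) (i : ℕ) :
    HF.map e.toEquiv (P.state y i) = P.state y i := by
  induction i with
  | zero => exact HF.map_empty _
  | succ i ih => exact map_eval_of_fixed P.step ih hy

theorem Outputs.map_eq {P : CPTProgram L} {e : A ≃[L] A} {y z : HF A} (h : P.Outputs y z)
    (hy : HF.map e.toEquiv y = y) : HF.map e.toEquiv z = z := by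
  obtain ⟨i, -, -, rfl, -⟩ := h
  exact map_eval_of_fixed P.out (P.map_state hy i) hy

/-- A computed object lies in the transitive closure of a bounded object that is invariant under
all automorphisms. -/
theorem Computes.exists_invariant {P : CPTProgram L} {x : HF A} (h : P.Computes x) :
    ∃ z : HF A, P.Bounded z ∧ x ∈ HF.tc z ∧ ∀ e : A ≃[L] A, HF.map e.toEquiv z = z := by
  rcases h with ⟨i, hi, hx⟩ | ⟨z, hz, hx⟩
  · exact ⟨_, hi.2.2 i le_rfl, hx, fun e => P.map_state (HF.map_empty _) i⟩
  · refine ⟨z, ?_, hx, fun e => hz.map_eq (HF.map_empty _)⟩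
    obtain ⟨i, -, -, -, hb⟩ := hz
    exact hb

end CPTProgram

end Invariance

section NestedRep

variable {A : Type}

theorem atom_notMem_elements_nestedRep (a : A) (l : List (Finset A)) :
    HF.atom a ∉ (nestedRep l).elements := by
  have h (C : Finset A) (y : HF A) (hy : ∀ a : A, HF.atom a ≠ y) :
      HF.atom a ∉ (HF.pair (HF.ofAtoms C) y).elements := by
    simp only [HF.pair, HF.elements_ofFinset, Finset.mem_insert, Finset.mem_singleton, not_or]
    exact ⟨HF.atom_ne_ofFinset _ _, hy a⟩
  match l with
  | [] => simp [nestedRep, HF.empty]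
  | [C] => exact h C _ fun a => HF.atom_ne_ofFinset _ _
  | [C, D] => exact h C _ fun a => HF.atom_ne_ofFinset _ _
  | C :: D :: E :: l => exact h C _ fun a => HF.atom_ne_ofFinset _ _

/-- A map that fixes the natural representation of a sequence of nonempty sets fixes all of them. -/
theorem map_ofAtoms_of_map_nestedRep {f : A → A} (l : List (Finset A))
    (hl : ∀ C ∈ l, C.Nonempty) (h : HF.map f (nestedRep l) = nestedRep l) :
    ∀ C ∈ l, HF.map f (HF.ofAtoms C) = HF.ofAtoms C := by
  classical
  induction l with
  | nil => simp
  | cons C l ih =>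
    cases l with
    | nil =>
      have := congrArg HF.elements h
      simpa [nestedRep, HF.pair] using this
    | cons D l =>
      rw [nestedRep, HF.map_pair] at h
      have h := congrArg HF.elements h
      simp only [HF.pair, HF.elements_ofFinset] at h
      obtain ⟨a, ha⟩ := hl C (by simp)
      have ha' : HF.atom a ∈ (HF.ofAtoms C).elements := by
        simpa [HF.ofAtoms] using ⟨a, ha, rfl⟩
      have hC : HF.map f (HF.ofAtoms C) ≠ nestedRep (D :: l) := fun he => by
        refine atom_notMem_elements_nestedRep (f a) (D :: l) ?_
        rw [← he, HF.elements_map, ← HF.map_atom]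
        exact Finset.mem_image_of_mem _ ha'
      have hD : HF.map f (nestedRep (D :: l)) ≠ HF.ofAtoms C := fun he => by
        rw [← he, HF.elements_map, Finset.mem_image] at ha'
        obtain ⟨y, hy, hya⟩ := ha'
        rcases HF.exists_atom_or_ofFinset y with ⟨b, rfl⟩ | ⟨s, rfl⟩
        · exact atom_notMem_elements_nestedRep b _ hy
        · rw [HF.map_ofFinset] at hya
          exact HF.atom_ne_ofFinset _ _ hya.symm
      have h₁ : HF.map f (HF.ofAtoms C) = HF.ofAtoms C := by
        have : HF.map f (HF.ofAtoms C) ∈ ({HF.ofAtoms C, nestedRep (D :: l)} : Finset (HF A)) := by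
          rw [← h]; simp
        simpa [hC] using this
      have h₂ : HF.map f (nestedRep (D :: l)) = nestedRep (D :: l) := by
        have : HF.map f (nestedRep (D :: l)) ∈
            ({HF.ofAtoms C, nestedRep (D :: l)} : Finset (HF A)) := by
          rw [← h]; simp
        simpa [hD] using this
      intro E hE
      rcases List.mem_cons.1 hE with rfl | hE
      · exact h₁
      · exact ih (fun C hC => hl C (List.mem_cons_of_mem _ hC)) h₂ E hE

/-- Automorphisms that fix an encoding of a preorder preserve its colour classes. -/
theorem Encodes.apply_mem_colourClass {L : FirstOrder.Language.{0, 0}} [Fintype A] [L.Structure A]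
    {x : HF A} {r : A → A → Prop} (hr : ∀ v, r v v) (h : Encodes L x r) {e : A ≃[L] A}
    (he : HF.map e.toEquiv x = x) (v : A) : e v ∈ colourClass r v := by
  classical
  obtain ⟨l, ⟨hl, -⟩, Q, hQ⟩ := h
  have hmem (v : A) : v ∈ colourClass r v := by simp [colourClass, hr]
  have := map_ofAtoms_of_map_nestedRep l
    (fun C hC => by obtain ⟨v, rfl⟩ := (hl C).1 hC; exact ⟨v, hmem v⟩)
    (hQ.map_eq he) _ ((hl _).2 ⟨v, rfl⟩)
  rw [HF.map_ofAtoms] at this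
  rw [← HF.ofAtoms_injective this]
  exact Finset.mem_image_of_mem _ (hmem v)

end NestedRep

section Hypercube

/-- The automorphism of the hypercube that permutes the coordinates. -/
def hypercubePerm {n : ℕ} (σ : Equiv.Perm (Fin n)) :
    (Fin n → Bool) ≃[FirstOrder.Language.graph] (Fin n → Bool) where
  toEquiv := σ.arrowCongr (Equiv.refl Bool)
  map_fun' := fun f => nomatch f
  map_rel' := fun R a => by
    cases R
    change hammingDist _ _ = 1 ↔ hammingDist _ _ = 1
    suffices h : ∀ u v : Fin n → Bool,
        hammingDist (u ∘ σ.symm) (v ∘ σ.symm) = hammingDist u v by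
      exact (h _ _).congr_left
    intro u v
    unfold hammingDist
    exact Finset.card_equiv σ.symm (by simp)

theorem hypercubePerm_apply {n : ℕ} (σ : Equiv.Perm (Fin n)) (v : Fin n → Bool) :
    hypercubePerm σ v = v ∘ σ.symm := rfl

/-- The vertex of the hypercube that records the `j`-th binary digit of each coordinate index. -/
def digitVertex (n j : ℕ) : Fin n → Bool := fun i => (i : ℕ).testBit j

theorem perm_eq_of_digitVertex {n k : ℕ} (hk : n ≤ 2 ^ k) {σ τ : Equiv.Perm (Fin n)}
    (h : ∀ j < k, digitVertex n j ∘ σ = digitVertex n j ∘ τ) : σ = τ := by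
  ext i
  refine Nat.eq_of_testBit_eq fun j => ?_
  by_cases hj : j < k
  · exact congrFun (h j hj) i
  · have hlt (i : Fin n) : (i : ℕ) < 2 ^ j :=
      i.2.trans_le (hk.trans (Nat.pow_le_pow_right two_pos (not_lt.1 hj)))
    rw [Nat.testBit_lt_two_pow (hlt _), Nat.testBit_lt_two_pow (hlt _)]

theorem card_colourClass_le {A : Type} [Fintype A] (r : A → A → Prop) (v : A) :
    (colourClass r v).card ≤ maxColourClassSize r :=
  Finset.le_sup (f := fun v => (colourClass r v).card) (Finset.mem_univ v)

theorem factorial_le_of_computes {n k : ℕ} (hk : n ≤ 2 ^ k)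
    {P : CPTProgram FirstOrder.Language.graph} {r : (Fin n → Bool) → (Fin n → Bool) → Prop}
    (hr : ∀ v, r v v) {x : HF (Fin n → Bool)} (hP : P.Computes x)
    (hx : Encodes FirstOrder.Language.graph x r) :
    n.factorial ≤ P.bound.eval (2 ^ n) * maxColourClassSize r ^ k := by
  classical
  obtain ⟨z, hz, hxz, hinv⟩ := hP.exists_invariant
  have hcard : (HF.tc_finite z).toFinset.card ≤ P.bound.eval (2 ^ n) := by
    have : (HF.tc z).ncard ≤ P.bound.eval (Fintype.card (Fin n → Bool)) := hz
    rw [Set.ncard_eq_toFinset_card _ (HF.tc_finite z)] at this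
    simpa using this
  let g : Equiv.Perm (Fin n) → HF (Fin n → Bool) := fun σ => HF.map (hypercubePerm σ).toEquiv x
  have hg : ∀ σ ∈ Finset.univ, g σ ∈ (HF.tc_finite z).toFinset := fun σ _ => by
    rw [Set.Finite.mem_toFinset, ← hinv (hypercubePerm σ)]
    exact HF.map_mem_tc hxz
  have hfib : ∀ y ∈ (HF.tc_finite z).toFinset,
      (Finset.univ.filter fun σ => g σ = y).card ≤ maxColourClassSize r ^ k := by
    intro y _
    rcases (Finset.univ.filter fun σ => g σ = y).eq_empty_or_nonempty with h0 | ⟨τ, hτ⟩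
    · simp [h0]
    have hτ : g τ = y := by simpa using hτ
    calc
      _ ≤ (Fintype.piFinset fun j : Fin k => colourClass r (digitVertex n j)).card := by
        refine Finset.card_le_card_of_injOn
          (fun σ j => hypercubePerm (σ.trans τ.symm) (digitVertex n j)) ?_ ?_
        · intro σ hσ
          have hσ : g σ = y := by simpa using hσ
          refine Finset.mem_coe.2 (Fintype.mem_piFinset.2 fun j => hx.apply_mem_colourClass hr ?_ _)
          apply HF.map_injective (hypercubePerm τ).toEquiv
          rw [HF.map_map]
          refine Eq.trans (congrArg (HF.map · x) ?_) (hσ.trans hτ.symm)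
          funext v i
          change v _ = v _
          simp
        · intro σ _ σ' _ h
          have : (σ.trans τ.symm).symm = (σ'.trans τ.symm).symm :=
            perm_eq_of_digitVertex hk fun j hj => congrFun h ⟨j, hj⟩
          ext i
          simpa using congrArg Fin.val (congrArg τ
            (Equiv.congr_fun (Equiv.symm_bijective.injective this) i))
      _ ≤ maxColourClassSize r ^ k := by
        rw [Fintype.card_piFinset]
        refine (Finset.prod_le_pow_card _ _ _ fun j _ => card_colourClass_le r _).trans ?_
        simp
  calc
    n.factorial = (Finset.univ : Finset (Equiv.Perm (Fin n))).card := by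
      rw [Finset.card_univ, Fintype.card_perm, Fintype.card_fin]
    _ ≤ (maxColourClassSize r ^ k) * (HF.tc_finite z).toFinset.card :=
      Finset.card_le_mul_card_image_of_maps_to hg _ hfib
    _ ≤ _ := by rw [mul_comm]; exact Nat.mul_le_mul_right _ hcard

theorem Polynomial.exists_eval_le_mul_pow (p : Polynomial ℕ) :
    ∃ K d : ℕ, ∀ m, 1 ≤ m → p.eval m ≤ K * m ^ d := by
  refine ⟨∑ i ∈ Finset.range (p.natDegree + 1), p.coeff i, p.natDegree, fun m hm => ?_⟩
  rw [Polynomial.eval_eq_sum_range, Finset.sum_mul]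
  refine Finset.sum_le_sum fun i hi => Nat.mul_le_mul_left _ (Nat.pow_le_pow_right hm ?_)
  exact Nat.lt_succ_iff.1 (Finset.mem_range.1 hi)

theorem two_mul_sq_le_two_pow {k : ℕ} (hk : 7 ≤ k) : 2 * (k + 1) ^ 2 ≤ 2 ^ k := by
  induction k, hk using Nat.le_induction with
  | base => norm_num
  | succ k hk ih => rw [pow_succ 2 k]; nlinarith

theorem pow_log_add_one_le {n : ℕ} (hn : 128 ≤ n) :
    (n * n) ^ (Nat.log 2 n + 1) ≤ 2 ^ n := by
  have hk : 7 ≤ Nat.log 2 n := Nat.le_log_of_pow_le one_lt_two (by simpa using hn)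
  have hlt : n ≤ 2 ^ (Nat.log 2 n + 1) := (Nat.lt_pow_succ_log_self one_lt_two n).le
  calc
    (n * n) ^ (Nat.log 2 n + 1)
        ≤ (2 ^ (Nat.log 2 n + 1) * 2 ^ (Nat.log 2 n + 1)) ^ (Nat.log 2 n + 1) :=
      Nat.pow_le_pow_left (Nat.mul_le_mul hlt hlt) _
    _ = 2 ^ (2 * (Nat.log 2 n + 1) ^ 2) := by
      rw [← pow_add, ← pow_mul]
      congr 1
      ring
    _ ≤ 2 ^ n := Nat.pow_le_pow_right two_pos
      ((two_mul_sq_le_two_pow hk).trans (Nat.pow_log_le_self 2 (by omega)))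

theorem eventually_mul_pow_lt_factorial (K a : ℕ) : ∀ᶠ n in atTop, K * a ^ n < n.factorial := by
  have h := (FloorSemiring.tendsto_pow_div_factorial_atTop (a : ℝ)).const_mul (K : ℝ)
  rw [mul_zero] at h
  filter_upwards [h.eventually_lt_const one_pos] with n hn
  have hpos : (0 : ℝ) < n.factorial := by exact_mod_cast n.factorial_pos
  rw [← mul_div_assoc, div_lt_one hpos] at hn
  exact_mod_cast hn

theorem eventually_le_mul_of_isBigO {f : ℕ → ℕ}
    (h : (fun n => (f n : ℝ)) =O[atTop] (fun n : ℕ => (n : ℝ))) :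
    ∀ᶠ n in atTop, f n ≤ n * n := by
  obtain ⟨c, hc⟩ := h.bound
  filter_upwards [hc, eventually_ge_atTop ⌈c⌉₊] with n hn hcn
  have hcn : c ≤ n := Nat.ceil_le.1 hcn
  simp only [Real.norm_natCast] at hn
  have : (f n : ℝ) ≤ n * n := hn.trans (by gcongr)
  exact_mod_cast this

end Hypercube

theorem mainTheorem2 :
    ¬ ∃ (P : CPTProgram FirstOrder.Language.graph) (r : ∀ n : ℕ, (Fin n → Bool) → (Fin n → Bool) → Prop),
      (∀ n, IsPreorder (Fin n → Bool) (r n) ∧ Std.Total (r n)) ∧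
      (fun n : ℕ => (maxColourClassSize (r n) : ℝ)) =O[atTop] (fun n : ℕ => (n : ℝ)) ∧
      ∀ n, ∃ x : HF (Fin n → Bool), P.Computes x ∧ Encodes FirstOrder.Language.graph x (r n) := by
  rintro ⟨P, r, hr, hO, h⟩
  obtain ⟨K, d, hp⟩ := Polynomial.exists_eval_le_mul_pow P.bound
  have hfalse : ∀ᶠ _ : ℕ in atTop, False := by
    filter_upwards [eventually_le_mul_of_isBigO hO, eventually_ge_atTop 128,
      eventually_mul_pow_lt_factorial K (2 ^ (d + 1))] with n hM hn hlt
    obtain ⟨x, hPx, hx⟩ := h n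
    refine hlt.not_ge ?_
    calc
      n.factorial ≤ P.bound.eval (2 ^ n) * maxColourClassSize (r n) ^ (Nat.log 2 n + 1) :=
        factorial_le_of_computes (Nat.lt_pow_succ_log_self one_lt_two n).le
          (hr n).1.refl hPx hx
      _ ≤ (K * (2 ^ n) ^ d) * 2 ^ n :=
        Nat.mul_le_mul (hp _ Nat.one_le_two_pow)
          ((Nat.pow_le_pow_left hM _).trans (pow_log_add_one_le hn))
      _ = K * (2 ^ (d + 1)) ^ n := by
        rw [mul_assoc, ← pow_succ, ← pow_mul, ← pow_mul, mul_comm n]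
  exact hfalse.exists.elim fun _ h => h
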